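/- Let $\Delta$ be a finite set (with the discrete topology), and give $\Delta^{\mathbb Z}$ and $\Delta^{\mathbb N}$ ($\mathbb N=\{1,2,\dots\}$) their product topologies and Borel $\sigma$-algebras. For a probability measure $Q$ on $\Delta^{\mathbb N}$ and a word $d_1\cdots d_n\in\Delta^n$, $n\ge 0$, let $\tau_{d_1\cdots d_n}(Q)$ be the finite measure $B\mapsto Q\bigl([d_1,\dots,d_n]\cap\sigma^{-n}(B)\bigr)$ on $\Delta^{\mathbb N}$, where $[d_1,\dots,d_n]$ is the set of sequences that begin with $d_1,\dots,d_n$ and $\sigma$ is the left shift. Let $V_Q$ be the linear hull of all the measures $\tau_{d_1\cdots d_n}(Q)$ in the space of finite signed measures on $\Delta^{\mathbb N}$. For a shift-invariant probability measure $P$ on $\Delta^{\mathbb Z}$ put $\dim(P):=\dim(V_{P_{\mathbb N}})\in\mathbb N\cup\{\infty\}$, where $P_{\mathbb N}$ is the image of $P$ under the restriction $(x_k)_{k\in\mathbb Z}\mapsto(x_k)_{k\ge1}$ to positive times, and where every infinite dimension is counted as $\infty$. Let $\mathcal P_{\mathrm e}(\Delta^{\mathbb Z})$ be the set of shift-invariant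 ergodic probability measures on $\Delta^{\mathbb Z}$, with the topology of weak convergence. Let $P$ be a shift-invariant probability measure on $\Delta^{\mathbb Z}$ with ergodic decomposition $\nu$, that is, $\nu$ is a probability measure on $\mathcal P_{\mathrm e}(\Delta^{\mathbb Z})$ with $P(B)=\int\mu(B)\,d\nu(\mu)$ for all measurable $B\subseteq\Delta^{\mathbb Z}$. Then $$\dim(P)=\sum_{\mu\in\operatorname{supp}(\nu)}\dim(\mu),$$ where $\operatorname{supp}(\nu)\subseteq\mathcal P_{\mathrm e}(\Delta^{\mathbb Z})$ is the topological support of $\nu$ (the set of $\mu$ all of whose neighbourhoods have positive $\nu$-measure), and the sum takes values in $[0,\infty]$; in particular, a sum over uncountably many strictly positive terms is infinite. -/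

import Mathlib

open MeasureTheory
open scoped ENNReal

noncomputable section

namespace ProcessDimension

/-- The left shift on two-sided sequences. -/
def shift (Δ : Type*) : (ℤ → Δ) → (ℤ → Δ) := fun x k => x (k + 1)

/-- The restriction `(x_k)_{k ∈ ℤ} ↦ (x_1, x_2, …)` to positive times; the one-sided sequence
`(x_1, x_2, …)` is stored with index set `ℕ = {0, 1, …}`. -/
def future (Δ : Type*) : (ℤ → Δ) → (ℕ → Δ) := fun x k => x ((k : ℤ) + 1)

/-- The `n`-th iterate of the left shift on one-sided sequences. -/
def dropFirst (Δ : Type*) (n : ℕ) : (ℕ → Δ) → (ℕ → Δ) := fun x k => x (k + n)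

/-- The cylinder `[d₁, …, dₙ]` of one-sided sequences that start with the word `d₁ ⋯ dₙ`. -/
def wordCylinder {Δ : Type*} {n : ℕ} (w : Fin n → Δ) : Set (ℕ → Δ) := {x | ∀ i : Fin n, x i = w i}

section

variable {Δ : Type*} [MeasurableSpace Δ]

/-- `τ_{d₁ ⋯ dₙ}(Q)`, the finite measure `B ↦ Q([d₁, …, dₙ] ∩ σ⁻ⁿ(B))` on one-sided sequences,
where `σ` is the left shift. -/
def wordMeasure (Q : Measure (ℕ → Δ)) {n : ℕ} (w : Fin n → Δ) : Measure (ℕ → Δ) :=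
  (Q.restrict (wordCylinder w)).map (dropFirst Δ n)

instance (Q : Measure (ℕ → Δ)) [IsFiniteMeasure Q] {n : ℕ} (w : Fin n → Δ) :
    IsFiniteMeasure (wordMeasure Q w) := by
  unfold wordMeasure; infer_instance

/-- The set of all `τ_{d₁ ⋯ dₙ}(Q)`, for all words of length `n ≥ 0`, as signed measures. -/
def canonicalSet (Q : Measure (ℕ → Δ)) [IsFiniteMeasure Q] : Set (SignedMeasure (ℕ → Δ)) :=
  {s | ∃ (n : ℕ) (w : Fin n → Δ), s = (wordMeasure Q w).toSignedMeasure}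

/-- The canonical OOM vector space of a one-sided process: the linear hull of `canonicalSet Q`. -/
def canonicalSpace (Q : Measure (ℕ → Δ)) [IsFiniteMeasure Q] :
    Submodule ℝ (SignedMeasure (ℕ → Δ)) :=
  Submodule.span ℝ (canonicalSet Q)

/-- The process dimension of a two-sided process `P`: the algebraic dimension, in `ℕ ∪ {∞}`, of the
canonical OOM vector space of the restriction of `P` to positive times. -/
def dim (P : ProbabilityMeasure (ℤ → Δ)) : ℕ∞ :=
  Cardinal.toENat (Module.rank ℝ (canonicalSpace ((P : Measure (ℤ → Δ)).map (future Δ))))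

/-- Stationarity: invariance of the law under the shift. -/
def IsStationary (P : ProbabilityMeasure (ℤ → Δ)) : Prop :=
  MeasurePreserving (shift Δ) (P : Measure (ℤ → Δ)) (P : Measure (ℤ → Δ))

end

/-- The space of (stationary) ergodic laws on `Δ^ℤ`. Its topology is the topology of weak
convergence and its σ-algebra is generated by the maps `μ ↦ μ B`, `B` measurable. -/
abbrev ErgodicLaw (Δ : Type*) [MeasurableSpace Δ] : Type _ :=
  {μ : ProbabilityMeasure (ℤ → Δ) // Ergodic (shift Δ) (μ : Measure (ℤ → Δ))}

/-- `ν` is an ergodic decomposition of `P`: a probability measure on the ergodic laws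
with `P = ∫ μ dν(μ)`. -/
def IsErgodicDecomposition {Δ : Type*} [MeasurableSpace Δ]
    (ν : ProbabilityMeasure (ErgodicLaw Δ)) (P : ProbabilityMeasure (ℤ → Δ)) : Prop :=
  ∀ B : Set (ℤ → Δ), MeasurableSet B →
    (P : Measure (ℤ → Δ)) B =
      ∫⁻ μ : ErgodicLaw Δ, (μ.1 : Measure (ℤ → Δ)) B ∂(ν : Measure (ErgodicLaw Δ))

end ProcessDimension

end

/-! Encode a law `μ` by its word function `p_μ(w) = μ[w]`. The dimension of `μ` is that of the span
`V_μ` of the translates `v ↦ p_μ(w ++ v)` (`dim_eq_rank_translateSpan`). If `μ` is ergodic,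
inserting words of length `k` between `w` and `v` and averaging over `k` sends `p_μ(w ++ v)` to
`p_μ(w) p_μ(v)`.

By linearity the same averages send `f ∈ V_μ` to `f(w) p_μ(v)`. With Dedekind's independence of
characters this makes the spaces `V_μ` of distinct ergodic laws linearly independent
(`AverageMultiplicative.eq_zero_of_sum_eq_zero`).

For `≥`, let `V_P` be finite-dimensional. The averages of `p_P` converge to the Gram kernel `∫
p_μ(w) p_μ(v) dν(μ)`, whose rows lie in `V_P`, since finite-dimensional subspaces are closed. A word
combination killed by the kernel has zero norm in `L²(ν)`, so by continuity it vanishes on the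
support. By duality `p_μ` is then a combination of rows, so `V_μ ≤ V_P` for `μ` in the support
(`wordProb_mem_translateSpan_of_mem_support`), and independence concludes.

For `≤`, an infinite support makes the sum infinite, since each term is at least 1. For a finite
support, `p_P` is a combination of the `p_μ`, so `V_P ≤ ⨆ V_μ`. -/

noncomputable section

namespace ProcessDimension

open Filter Topology

/-! ### Functions on words and asymptotic decoupling -/

section WordFunctions

variable {Δ : Type*}

/-- The span of the left translates `v ↦ f (w ++ v)` of a function on words. -/
def translateSpan (f : List Δ → ℝ) : Submodule ℝ (List Δ → ℝ) :=
  Submodule.span ℝ (Set.range fun w v => f (w ++ v))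

lemma translate_mem (f : List Δ → ℝ) (w : List Δ) : (fun v => f (w ++ v)) ∈ translateSpan f :=
  Submodule.subset_span ⟨w, rfl⟩

lemma self_mem_translateSpan (f : List Δ → ℝ) : f ∈ translateSpan f := translate_mem f []

lemma translate_mem_of_mem {f g : List Δ → ℝ} (hg : g ∈ translateSpan f) (w : List Δ) :
    (fun v => g (w ++ v)) ∈ translateSpan f := by
  induction hg using Submodule.span_induction with
  | mem g hg =>
    obtain ⟨u, rfl⟩ := hg
    simpa using translate_mem f (u ++ w)
  | zero => exact zero_mem _
  | add g h _ _ hg hh => exact add_mem hg hh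
  | smul c g _ hg => exact Submodule.smul_mem _ c hg

lemma translateSpan_le {f g : List Δ → ℝ} (hg : g ∈ translateSpan f) :
    translateSpan g ≤ translateSpan f := by
  rw [translateSpan, Submodule.span_le]
  rintro _ ⟨w, rfl⟩
  exact translate_mem_of_mem hg w

variable [Fintype Δ]

/-- The sum of `f (w ++ u ++ v)` over all words `u` of length `k`. -/
def bridge (f : List Δ → ℝ) : ℕ → List Δ → List Δ → ℝ
  | 0, w, v => f (w ++ v)
  | k + 1, w, v => ∑ d, bridge f k (w ++ [d]) v

/-- The Cesàro mean of `k ↦ bridge f k w v` over `k < N`. -/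
def bridgeMean (f : List Δ → ℝ) (N : ℕ) (w v : List Δ) : ℝ :=
  (N : ℝ)⁻¹ * ∑ k ∈ Finset.range N, bridge f k w v

lemma bridge_sum {ι : Type*} (s : Finset ι) (c : ι → ℝ) (f : ι → List Δ → ℝ) (k : ℕ)
    (w v : List Δ) :
    bridge (∑ i ∈ s, c i • f i) k w v = ∑ i ∈ s, c i * bridge (f i) k w v := by
  induction k generalizing w with
  | zero => simp [bridge]
  | succ k ih => simp only [bridge, ih, Finset.mul_sum]; rw [Finset.sum_comm]

lemma bridgeMean_sum {ι : Type*} (s : Finset ι) (c : ι → ℝ) (f : ι → List Δ → ℝ) (N : ℕ)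
    (w v : List Δ) :
    bridgeMean (∑ i ∈ s, c i • f i) N w v = ∑ i ∈ s, c i * bridgeMean (f i) N w v := by
  simp only [bridgeMean, bridge_sum, Finset.mul_sum]
  rw [Finset.sum_comm]
  exact Finset.sum_congr rfl fun i _ => Finset.sum_congr rfl fun k _ => by ring

lemma bridgeMean_zero (N : ℕ) (w v : List Δ) : bridgeMean (0 : List Δ → ℝ) N w v = 0 := by
  simpa using bridgeMean_sum (∅ : Finset ℕ) 0 0 N w v

lemma bridgeMean_add (f g : List Δ → ℝ) (N : ℕ) (w v : List Δ) :
    bridgeMean (f + g) N w v = bridgeMean f N w v + bridgeMean g N w v := by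
  simpa using bridgeMean_sum Finset.univ 1 ![f, g] N w v

lemma bridgeMean_smul (c : ℝ) (f : List Δ → ℝ) (N : ℕ) (w v : List Δ) :
    bridgeMean (c • f) N w v = c * bridgeMean f N w v := by
  simpa using bridgeMean_sum {()} (fun _ => c) (fun _ => f) N w v

lemma bridge_translate (f : List Δ → ℝ) (u : List Δ) (k : ℕ) (w v : List Δ) :
    bridge (fun x => f (u ++ x)) k w v = bridge f k (u ++ w) v := by
  induction k generalizing w with
  | zero => simp [bridge]
  | succ k ih => simp [bridge, ih]

lemma bridgeMean_translate (f : List Δ → ℝ) (u : List Δ) (N : ℕ) (w v : List Δ) :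
    bridgeMean (fun x => f (u ++ x)) N w v = bridgeMean f N (u ++ w) v := by
  simp [bridgeMean, bridge_translate]

lemma bridge_mem (f : List Δ → ℝ) (k : ℕ) (w : List Δ) : bridge f k w ∈ translateSpan f := by
  induction k generalizing w with
  | zero => exact translate_mem f w
  | succ k ih =>
    have : bridge f (k + 1) w = ∑ d, bridge f k (w ++ [d]) := by ext v; simp [bridge]
    rw [this]
    exact Submodule.sum_mem _ fun d _ => ih _

lemma bridgeMean_mem (f : List Δ → ℝ) (N : ℕ) (w : List Δ) :
    bridgeMean f N w ∈ translateSpan f := by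
  have : bridgeMean f N w = (N : ℝ)⁻¹ • ∑ k ∈ Finset.range N, bridge f k w := by
    ext v; simp [bridgeMean]
  rw [this]
  exact Submodule.smul_mem _ _ (Submodule.sum_mem _ fun k _ => bridge_mem f k w)

/-- Every Cesàro mean is a combination of translates, and a finite-dimensional subspace is closed
under pointwise limits. -/
lemma mem_translateSpan_of_tendsto {f g : List Δ → ℝ} [FiniteDimensional ℝ (translateSpan f)]
    {w : List Δ} (h : ∀ v, Tendsto (fun N => bridgeMean f N w v) atTop (𝓝 (g v))) :
    g ∈ translateSpan f :=
  (Submodule.closed_of_finiteDimensional (translateSpan f)).mem_of_tendsto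
    (tendsto_pi_nhds.2 h) (Eventually.of_forall fun N => bridgeMean_mem f N w)

/-- A function on words, normalised on the empty word, is average-multiplicative if inserting words
of length `k` and averaging over `k` decouples the two outer words. -/
structure AverageMultiplicative (p : List Δ → ℝ) : Prop where
  nil : p [] = 1
  tendsto (w v : List Δ) : Tendsto (fun N => bridgeMean p N w v) atTop (𝓝 (p w * p v))

/-- A translate by `u` is absorbed into the left outer word, so only the left factor changes from
`p` to `f`. -/
lemma AverageMultiplicative.tendsto_of_mem {p f : List Δ → ℝ} (hp : AverageMultiplicative p)
    (hf : f ∈ translateSpan p) (w v : List Δ) :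
    Tendsto (fun N => bridgeMean f N w v) atTop (𝓝 (f w * p v)) := by
  induction hf using Submodule.span_induction with
  | mem f hf =>
    obtain ⟨u, rfl⟩ := hf
    simpa only [bridgeMean_translate] using hp.tendsto (u ++ w) v
  | zero => simp [bridgeMean_zero]
  | add f g _ _ hf hg => simpa only [bridgeMean_add, Pi.add_apply, add_mul] using hf.add hg
  | smul c f _ hf =>
    simpa only [bridgeMean_smul, Pi.smul_apply, smul_eq_mul, mul_assoc] using hf.const_mul c

lemma AverageMultiplicative.sum_mul_eq_zero {ι : Type*} {p f : ι → List Δ → ℝ} {s : Finset ι}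
    (hp : ∀ i ∈ s, AverageMultiplicative (p i)) (hf : ∀ i ∈ s, f i ∈ translateSpan (p i))
    (h : ∑ i ∈ s, f i = 0) (w v : List Δ) : ∑ i ∈ s, f i w * p i v = 0 := by
  have h1 := tendsto_finsetSum s fun i hi => (hp i hi).tendsto_of_mem (hf i hi) w v
  refine tendsto_nhds_unique h1 ?_
  have h2 := fun N => bridgeMean_sum s 1 f N w v
  simp only [Pi.one_apply, one_smul, one_mul, h, bridgeMean_zero] at h2
  simp [← h2]

lemma AverageMultiplicative.linearIndependent {ι : Type*} {p : ι → List Δ → ℝ}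
    (hp : ∀ i, AverageMultiplicative (p i)) (hinj : Function.Injective p) :
    LinearIndependent ℝ p := by
  rw [linearIndependent_iff']
  intro s c hc
  -- A relation among the `p i` survives multiplying its coefficients by `p i w`; iterate this along
  -- a list of words.
  have key : ∀ l : List (List Δ), ∑ i ∈ s, (c i * (l.map (p i)).prod) • p i = 0 := by
    intro l
    induction l with
    | nil => simpa using hc
    | cons w l ih =>
      ext v
      have := AverageMultiplicative.sum_mul_eq_zero (fun i _ => hp i)
        (fun i _ => Submodule.smul_mem _ _ (self_mem_translateSpan (p i))) ih w v
      simp only [Finset.sum_apply, Pi.smul_apply, smul_eq_mul, List.map_cons, List.prod_cons,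
        Pi.zero_apply] at this ⊢
      rw [← this]
      exact Finset.sum_congr rfl fun i _ => by ring
  -- `p i` is not multiplicative under concatenation, so words serve as the free generators.
  -- Evaluating `key` at the empty word gives a relation between these characters.
  let χ : ι → (FreeMonoid (List Δ) →* ℝ) := fun i => FreeMonoid.lift (p i)
  have hχ : LinearIndependent ℝ fun i => (χ i : FreeMonoid (List Δ) → ℝ) :=
    (linearIndependent_monoidHom (FreeMonoid (List Δ)) ℝ).comp χ
      (FreeMonoid.lift.injective.comp hinj)
  rw [linearIndependent_iff'] at hχ
  refine hχ s c ?_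
  ext l
  have := congrFun (key l.toList) []
  simpa [χ, (hp _).nil, FreeMonoid.lift_apply] using this

/-- For fixed `w`, decoupling turns the relation into one among the independent `p i`, with
coefficients `f i w`. -/
lemma AverageMultiplicative.eq_zero_of_sum_eq_zero {ι : Type*} {p f : ι → List Δ → ℝ}
    {s : Finset ι} (hp : ∀ i, AverageMultiplicative (p i)) (hinj : Function.Injective p)
    (hf : ∀ i ∈ s, f i ∈ translateSpan (p i)) (h : ∑ i ∈ s, f i = 0) : ∀ i ∈ s, f i = 0 := by
  intro i hi
  ext w
  refine linearIndependent_iff'.1 (AverageMultiplicative.linearIndependent hp hinj) s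
    (fun i => f i w) ?_ i hi
  ext v
  simpa using AverageMultiplicative.sum_mul_eq_zero (fun i _ => hp i) hf h w v

end WordFunctions

/-! ### Duality with point evaluations -/

section FunctionSpaces

variable {W : Type*}

/-- On a finite-dimensional space of functions, each linear functional is a finite combination of
point evaluations. -/
lemma exists_finsupp_of_dual (F : Submodule ℝ (W → ℝ)) [FiniteDimensional ℝ F]
    (l : Module.Dual ℝ F) :
    ∃ a : W →₀ ℝ, ∀ f : F, l f = Finsupp.linearCombination ℝ (f : W → ℝ) a := by
  let B : F →ₗ[ℝ] Module.Dual ℝ (W →₀ ℝ) :=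
    (Finsupp.llift ℝ ℝ ℝ W).toLinearMap.comp F.subtype
  -- Point evaluations separate functions; in finite dimension this makes the transposed pairing
  -- surjective.
  have hB : Function.Injective B :=
    (Finsupp.llift ℝ ℝ ℝ W).injective.comp F.injective_subtype
  obtain ⟨a, ha⟩ := LinearMap.flip_surjective_iff₁.2 hB l
  refine ⟨a, fun f => ?_⟩
  rw [← ha]
  simp [B, Finsupp.linearCombination_apply]

lemma exists_finsupp_dual_basis {ι : Type*} [Finite ι] [DecidableEq ι] {p : ι → W → ℝ}
    (hp : LinearIndependent ℝ p) (i : ι) :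
    ∃ a : W →₀ ℝ, ∀ j, Finsupp.linearCombination ℝ (p j) a = if j = i then 1 else 0 := by
  have : FiniteDimensional ℝ (Submodule.span ℝ (Set.range p)) :=
    FiniteDimensional.span_of_finite ℝ (Set.finite_range p)
  obtain ⟨a, ha⟩ := exists_finsupp_of_dual _ ((Module.Basis.span hp).coord i)
  refine ⟨a, fun j => ?_⟩
  have h := ha (Module.Basis.span hp j)
  rw [Module.Basis.span_apply] at h
  rw [← h]
  simp [Finsupp.single_apply]

end FunctionSpaces

/-! ### Dimension counts in `ℕ∞` -/

section Ranks

open Cardinal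

lemma toENat_rank_pi {ι : Type*} [Fintype ι] (M : ι → Type*) [∀ i, AddCommGroup (M i)]
    [∀ i, Module ℝ (M i)] :
    toENat (Module.rank ℝ (∀ i, M i)) = ∑ i, toENat (Module.rank ℝ (M i)) := by
  by_cases h : ∀ i, Module.Finite ℝ (M i)
  · simp [← Module.finrank_eq_rank, Module.finrank_pi_fintype]
  · push Not at h
    obtain ⟨i, hi⟩ := h
    have h1 : ¬ Module.Finite ℝ (∀ i, M i) := fun h =>
      hi (Module.Finite.of_surjective (LinearMap.proj i) (Function.surjective_eval i))
    have h2 : toENat (Module.rank ℝ (M i)) = ⊤ := by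
      rw [toENat_eq_top, ← not_lt, Module.rank_lt_aleph0_iff]; exact hi
    rw [toENat_eq_top.2 (by rwa [← not_lt, Module.rank_lt_aleph0_iff])]
    refine (top_unique ?_).symm
    rw [← h2]
    exact Finset.single_le_sum (f := fun i => toENat (Module.rank ℝ (M i)))
      (fun _ _ => zero_le) (Finset.mem_univ i)

lemma sum_toENat_rank_le {ι E : Type*} [AddCommGroup E] [Module ℝ E] (s : Finset ι)
    (V : ι → Submodule ℝ E) (U : Submodule ℝ E) (hV : ∀ i ∈ s, V i ≤ U)
    (hind : ∀ f : ι → E, (∀ i ∈ s, f i ∈ V i) → ∑ i ∈ s, f i = 0 → ∀ i ∈ s, f i = 0) :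
    ∑ i ∈ s, toENat (Module.rank ℝ (V i)) ≤ toENat (Module.rank ℝ U) := by
  classical
  rw [← Finset.sum_coe_sort s fun i => toENat (Module.rank ℝ (V i)), ← toENat_rank_pi]
  let L : (∀ i : s, V i) →ₗ[ℝ] U :=
    ∑ i : s, (Submodule.inclusion (hV i i.2)).comp (LinearMap.proj i)
  have hL : ∀ x, (L x : E) = ∑ i : s, (x i : E) := fun x => by simp [L]
  have hinj : Function.Injective L := by
    rw [← LinearMap.ker_eq_bot, LinearMap.ker_eq_bot']
    intro x hx
    have h0 : ∑ i : s, (x i : E) = 0 := by rw [← hL, hx]; rfl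
    have h1 := hind (fun i => if hi : i ∈ s then (x ⟨i, hi⟩ : E) else 0)
      (fun i hi => by simp [hi]) (by rw [← h0, ← Finset.sum_coe_sort s]; simp)
    ext i
    simpa using h1 i i.2
  simpa using OrderHomClass.mono toENat (LinearMap.lift_rank_le_of_injective L hinj)

lemma toENat_rank_le_sum {ι E : Type*} [AddCommGroup E] [Module ℝ E] [Fintype ι]
    (V : ι → Submodule ℝ E) (U : Submodule ℝ E) (hU : U ≤ ⨆ i, V i) :
    toENat (Module.rank ℝ U) ≤ ∑ i, toENat (Module.rank ℝ (V i)) := by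
  classical
  rw [← toENat_rank_pi]
  let L : (∀ i, V i) →ₗ[ℝ] E := ∑ i, (V i).subtype.comp (LinearMap.proj i)
  have hL : U ≤ LinearMap.range L := by
    refine hU.trans (iSup_le fun i x hx => ⟨Pi.single i ⟨x, hx⟩, ?_⟩)
    simp only [L, LinearMap.sum_apply, LinearMap.comp_apply, LinearMap.proj_apply,
      Submodule.subtype_apply]
    rw [Finset.sum_eq_single i (fun j _ hj => by simp [hj]) (by simp)]
    simp
  refine (OrderHomClass.mono toENat (Submodule.rank_mono hL)).trans ?_
  simpa using OrderHomClass.mono toENat (lift_rank_range_le L)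

end Ranks

/-! ### Von Neumann's mean ergodic theorem -/

section MeanErgodic

variable {X : Type*} [MeasurableSpace X] {μ : Measure X} [IsProbabilityMeasure μ] {T : X → X}

/-- The Koopman operator of a measure-preserving map on real `L²`. -/
def koopman (hT : MeasurePreserving T μ μ) : Lp ℝ 2 μ →L[ℝ] Lp ℝ 2 μ :=
  (Lp.compMeasurePreservingₗᵢ ℝ T hT).toContinuousLinearMap

lemma koopman_iterate_indicator (hT : MeasurePreserving T μ μ) {B : Set X} (hB : MeasurableSet B)
    (k : ℕ) : (koopman hT)^[k] (indicatorConstLp 2 hB (measure_ne_top μ B) (1 : ℝ)) =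
      indicatorConstLp 2 ((hT.measurable.iterate k) hB) (measure_ne_top μ _) (1 : ℝ) := by
  induction k with
  | zero => rfl
  | succ k ih =>
    rw [Function.iterate_succ_apply', ih]
    exact Lp.indicatorConstLp_compMeasurePreserving _ _ _ hT

/-- Ergodic maps are mixing in the Cesàro sense. -/
theorem _root_.Ergodic.tendsto_average_measureReal (hT : Ergodic T μ) {A B : Set X}
    (hA : MeasurableSet A) (hB : MeasurableSet B) :
    Tendsto (fun N : ℕ => (N : ℝ)⁻¹ * ∑ k ∈ Finset.range N, μ.real (A ∩ T^[k] ⁻¹' B)) atTop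
      (𝓝 (μ.real A * μ.real B)) := by
  let U := koopman hT.toMeasurePreserving
  let e : ∀ {A : Set X}, MeasurableSet A → Lp ℝ 2 μ := fun {A} hA =>
    indicatorConstLp 2 hA (measure_ne_top μ A) (1 : ℝ)
  have hU : ‖U‖ ≤ 1 := LinearIsometry.norm_toContinuousLinearMap_le _
  have hlim := U.tendsto_birkhoffAverage_orthogonalProjection hU (e hB)
  obtain ⟨g, hg⟩ : ∃ g,
      g = (U.eqLocus (1 : Lp ℝ 2 μ →L[ℝ] Lp ℝ 2 μ)).orthogonalProjectionOnto (e hB) :=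
    ⟨_, rfl⟩
  rw [← hg] at hlim
  have hfix : U g = g := g.2
  -- The limit is fixed by the Koopman operator, hence constant by ergodicity.
  obtain ⟨c, hc⟩ : ∃ c : ℝ, (g : Lp ℝ 2 μ) = c • e MeasurableSet.univ := by
    have h1 : (g : X → ℝ) ∘ T =ᵐ[μ] g := by
      refine (Lp.coeFn_compMeasurePreserving (g : Lp ℝ 2 μ) hT.toMeasurePreserving).symm.trans ?_
      exact Eq.eventuallyEq (congrArg (fun h : Lp ℝ 2 μ => (h : X → ℝ)) hfix)
    obtain ⟨c, hc⟩ := hT.ae_eq_const_of_ae_eq_comp_ae (Lp.aestronglyMeasurable _) h1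
    refine ⟨c, Lp.ext (hc.trans ?_)⟩
    filter_upwards [Lp.coeFn_smul c (e (MeasurableSet.univ)),
      indicatorConstLp_coeFn (p := 2) (hs := MeasurableSet.univ) (hμs := measure_ne_top μ _)
        (c := (1 : ℝ))] with x hx hx'
    rw [hx, Pi.smul_apply, hx']
    simp
  have hinner : ∀ {A : Set X} (hA : MeasurableSet A),
      Tendsto (fun N : ℕ => (N : ℝ)⁻¹ * ∑ k ∈ Finset.range N, μ.real (A ∩ T^[k] ⁻¹' B)) atTop
        (𝓝 (c * μ.real A)) := by
    intro A hA
    have h2 := (tendsto_const_nhds (x := e hA)).inner (𝕜 := ℝ) hlim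
    have h3 : inner ℝ (e hA) (g : Lp ℝ 2 μ) = c * μ.real A := by
      rw [hc, inner_smul_right, L2.real_inner_indicatorConstLp_one_indicatorConstLp_one]
      simp
    rw [h3] at h2
    refine h2.congr fun N => ?_
    rw [birkhoffAverage, birkhoffSum, inner_smul_right, inner_sum]
    refine congrArg _ (Finset.sum_congr rfl fun k _ => ?_)
    rw [id, koopman_iterate_indicator, L2.real_inner_indicatorConstLp_one_indicatorConstLp_one]
  -- Testing against the whole space makes the averages constant for `N ≠ 0`, which identifies `c`.
  have hcB : c = μ.real B := by
    have h4 := hinner MeasurableSet.univ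
    have h5 : ∀ k, μ.real (T^[k] ⁻¹' B) = μ.real B := fun k =>
      (hT.toMeasurePreserving.iterate k).measureReal_preimage hB.nullMeasurableSet
    simp only [Set.univ_inter, h5, Finset.sum_const, Finset.card_range, nsmul_eq_mul,
      probReal_univ, mul_one] at h4
    refine tendsto_nhds_unique h4 (tendsto_const_nhds.congr' ?_)
    filter_upwards [eventually_ne_atTop 0] with N hN
    field_simp
  rw [mul_comm, ← hcB]
  exact hinner hA

end MeanErgodic

/-! ### Cylinder sets and determination of laws -/

section Cylinders

variable {Δ : Type*}

/-- The two-sided sequences that carry the word `w` at the places `m + 1, …, m + |w|`. -/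
def cylinderAt (m : ℤ) : List Δ → Set (ℤ → Δ)
  | [] => Set.univ
  | d :: w => {x | x (m + 1) = d} ∩ cylinderAt (m + 1) w

lemma cylinderAt_append (m : ℤ) (w v : List Δ) :
    cylinderAt m (w ++ v) = cylinderAt m w ∩ cylinderAt (m + w.length) v := by
  induction w generalizing m with
  | nil => simp [cylinderAt]
  | cons d w ih =>
    simp only [List.cons_append, cylinderAt, ih, Set.inter_assoc, List.length_cons]
    rw [Nat.cast_succ, add_right_comm, add_assoc m]

lemma mem_cylinderAt {m : ℤ} {w : List Δ} {x : ℤ → Δ} :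
    x ∈ cylinderAt m w ↔ ∀ i : Fin w.length, x (m + i + 1) = w.get i := by
  induction w generalizing m with
  | nil => simp [cylinderAt]
  | cons d w ih =>
    simp only [cylinderAt, Set.mem_inter_iff, Set.mem_ofPred_eq, ih, List.length_cons,
      Fin.forall_fin_succ]
    simp [add_comm, add_left_comm]

lemma shift_iterate_apply (k : ℕ) (x : ℤ → Δ) (i : ℤ) : (shift Δ)^[k] x i = x (i + k) := by
  induction k generalizing x with
  | zero => simp
  | succ k ih => rw [Function.iterate_succ_apply, ih]; simp [shift, add_assoc]

lemma preimage_shift_iterate_cylinderAt (k : ℕ) (m : ℤ) (w : List Δ) :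
    (shift Δ)^[k] ⁻¹' cylinderAt m w = cylinderAt (m + k) w := by
  ext x
  simp only [Set.mem_preimage, mem_cylinderAt, shift_iterate_apply]
  simp [add_assoc, add_comm, add_left_comm]

lemma preimage_future_dropFirst (n : ℕ) (w : List Δ) :
    future Δ ⁻¹' (dropFirst Δ n ⁻¹' wordCylinder w.get) = cylinderAt n w := by
  ext x
  simp [mem_cylinderAt, wordCylinder, future, dropFirst, add_comm]

lemma wordCylinder_get_ofFn {n : ℕ} (w : Fin n → Δ) :
    wordCylinder (List.ofFn w).get = wordCylinder w := by
  ext x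
  simp only [wordCylinder, Set.mem_ofPred_eq]
  constructor
  · intro h i
    simpa using h (i.cast List.length_ofFn.symm)
  · intro h i
    exact (h (i.cast List.length_ofFn)).trans (List.get_ofFn w i).symm

lemma preimage_future_wordCylinder {n : ℕ} (w : Fin n → Δ) :
    future Δ ⁻¹' wordCylinder w = cylinderAt 0 (List.ofFn w) := by
  rw [← wordCylinder_get_ofFn w]
  exact preimage_future_dropFirst 0 _

lemma isClopen_cylinderAt [TopologicalSpace Δ] [DiscreteTopology Δ] (m : ℤ) (w : List Δ) :
    IsClopen (cylinderAt m w) := by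
  induction w generalizing m with
  | nil => exact isClopen_univ
  | cons d w ih =>
    exact ((isClopen_discrete {d}).preimage (continuous_apply (m + 1))).inter (ih _)

variable [MeasurableSpace Δ]

lemma measurable_future : Measurable (future Δ) := by
  unfold future; fun_prop

lemma measurable_dropFirst (n : ℕ) : Measurable (dropFirst Δ n) := by
  unfold dropFirst; fun_prop

/-- A stationary law is determined by its restriction to positive times. -/
lemma ext_of_map_future {μ ρ : Measure (ℤ → Δ)} [IsFiniteMeasure μ] [IsFiniteMeasure ρ]
    (hμ : MeasurePreserving (shift Δ) μ μ) (hρ : MeasurePreserving (shift Δ) ρ ρ)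
    (h : μ.map (future Δ) = ρ.map (future Δ)) : μ = ρ := by
  refine IsProjectiveLimit.unique (P := fun I : Finset ℤ => ρ.map I.restrict) (fun I => ?_)
    fun I => rfl
  -- Shifting by `n` moves `I` to positive times; the `- 1` reflects that `future` stores `x_1` at
  -- index 0.
  obtain ⟨n, hn⟩ : ∃ n : ℕ, ∀ i ∈ I, 0 ≤ i + n - 1 := by
    refine ⟨I.sup Int.natAbs + 1, fun i hi => ?_⟩
    have := Finset.le_sup (f := Int.natAbs) hi
    omega
  let F : (ℕ → Δ) → (I → Δ) := fun y i => y (i.1 + n - 1).toNat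
  have hF : Measurable F := by fun_prop
  have hc : I.restrict ∘ (shift Δ)^[n] = F ∘ future Δ := by
    ext x i
    have h0 := hn i i.2
    simp only [Function.comp_apply, Finset.restrict, shift_iterate_apply, F, future,
      Int.toNat_of_nonneg h0]
    congr 1
    ring
  have key : ∀ {μ : Measure (ℤ → Δ)}, MeasurePreserving (shift Δ) μ μ →
      μ.map I.restrict = (μ.map (future Δ)).map F := by
    intro μ hμ
    conv_lhs => rw [← (hμ.iterate n).map_eq]
    rw [Measure.map_map (Finset.measurable_restrict I) (hμ.iterate n).measurable, hc,
      Measure.map_map hF measurable_future]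
  change _ = ρ.map I.restrict
  rw [key hμ, key hρ, h]

variable [DiscreteMeasurableSpace Δ]

lemma measurableSet_cylinderAt (m : ℤ) (w : List Δ) : MeasurableSet (cylinderAt m w) := by
  induction w generalizing m with
  | nil => exact MeasurableSet.univ
  | cons d w ih =>
    exact ((measurable_pi_apply (m + 1)) (MeasurableSet.of_discrete (s := {d}))).inter (ih _)

lemma measurableSet_wordCylinder {n : ℕ} (w : Fin n → Δ) : MeasurableSet (wordCylinder w) := by
  have : wordCylinder w = ⋂ i : Fin n, (fun x : ℕ → Δ => x i) ⁻¹' {w i} := by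
    ext x; simp [wordCylinder]
  rw [this]
  exact MeasurableSet.iInter fun i => measurable_pi_apply _ MeasurableSet.of_discrete

/-- Word cylinders determine finite measures on one-sided sequences. -/
lemma ext_of_wordCylinder [Countable Δ] {Q R : Measure (ℕ → Δ)} [IsFiniteMeasure Q]
    [IsFiniteMeasure R]
    (h : ∀ (n : ℕ) (w : Fin n → Δ), Q (wordCylinder w) = R (wordCylinder w)) : Q = R := by
  have h1 : ∀ n : ℕ, Q.map (fun x (i : Fin n) => x i) = R.map fun x (i : Fin n) => x i := by
    intro n
    refine Measure.ext_of_singleton fun w => ?_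
    have hm : Measurable fun (x : ℕ → Δ) (i : Fin n) => x i := by fun_prop
    have hs : (fun (x : ℕ → Δ) (i : Fin n) => x i) ⁻¹' {w} = wordCylinder w := by
      ext x; simp [wordCylinder, funext_iff]
    rw [Measure.map_apply hm (measurableSet_singleton w),
      Measure.map_apply hm (measurableSet_singleton w), hs, h]
  refine IsProjectiveLimit.unique (P := fun I : Finset ℕ => R.map I.restrict) (fun I => ?_)
    fun I => rfl
  obtain ⟨n, hn⟩ : ∃ n, ∀ i ∈ I, i < n := ⟨I.sup id + 1, fun i hi =>
    Nat.lt_succ_of_le (Finset.le_sup (f := id) hi)⟩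
  let F : (Fin n → Δ) → (I → Δ) := fun x i => x ⟨i, hn i i.2⟩
  have hF : Measurable F := by fun_prop
  have hm : Measurable fun (x : ℕ → Δ) (i : Fin n) => x i := by fun_prop
  have hc : I.restrict = F ∘ fun (x : ℕ → Δ) (i : Fin n) => x i := rfl
  change _ = R.map I.restrict
  rw [hc, ← Measure.map_map hF hm, ← Measure.map_map hF hm, h1]

end Cylinders

/-! ### Word probabilities -/

section WordProb

variable {Δ : Type*} [MeasurableSpace Δ]

/-- The probability of a word under a two-sided process. -/
def wordProb (μ : Measure (ℤ → Δ)) (w : List Δ) : ℝ := μ.real (cylinderAt 0 w)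

variable [DiscreteMeasurableSpace Δ]

lemma bridge_wordProb [Fintype Δ] (μ : Measure (ℤ → Δ)) [IsFiniteMeasure μ] (k : ℕ)
    (w v : List Δ) :
    bridge (wordProb μ) k w v = μ.real (cylinderAt 0 w ∩ cylinderAt (w.length + k) v) := by
  induction k generalizing w with
  | zero => simp [bridge, wordProb, cylinderAt_append]
  | succ k ih =>
    simp only [bridge, ih, cylinderAt_append, List.length_append, List.length_singleton]
    set B := cylinderAt 0 w ∩ cylinderAt (w.length + (k + 1 : ℕ)) v with hB
    have h1 : ∀ d : Δ, cylinderAt 0 w ∩ cylinderAt (0 + w.length) [d] ∩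
        cylinderAt ((w.length + 1 : ℕ) + k) v =
          B ∩ (fun x : ℤ → Δ => x (w.length + 1)) ⁻¹' {d} := by
      intro d
      have h2 : (((w.length + 1 : ℕ) : ℤ) + k) = w.length + (k + 1 : ℕ) := by push_cast; ring
      rw [h2, hB, Set.inter_right_comm]
      congr 1
      ext x
      simp [cylinderAt]
    simp only [h1]
    -- The sum over the inserted letter partitions `B` by the coordinate at `|w| + 1`.
    have h3 := sum_measureReal_preimage_singleton (μ := μ.restrict B) Finset.univ
      (f := fun x : ℤ → Δ => x (w.length + 1))
      fun d _ => measurable_pi_apply _ (MeasurableSet.of_discrete (s := {d}))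
    simp only [Finset.coe_univ, Set.preimage_univ, measureReal_restrict_apply_univ] at h3
    rw [← h3]
    refine Finset.sum_congr rfl fun d _ => ?_
    rw [measureReal_restrict_apply (measurable_pi_apply _ MeasurableSet.of_discrete), Set.inter_comm]

lemma averageMultiplicative_wordProb [Fintype Δ] {μ : Measure (ℤ → Δ)} [IsProbabilityMeasure μ]
    (hμ : Ergodic (shift Δ) μ) : AverageMultiplicative (wordProb μ) := by
  refine ⟨by simp [wordProb, cylinderAt], fun w v => ?_⟩
  have h := hμ.tendsto_average_measureReal (measurableSet_cylinderAt 0 w)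
    (measurableSet_cylinderAt w.length v)
  have h2 : μ.real (cylinderAt w.length v) = wordProb μ v := by
    rw [wordProb, ← (hμ.toMeasurePreserving.iterate w.length).measureReal_preimage
      (measurableSet_cylinderAt 0 v).nullMeasurableSet, preimage_shift_iterate_cylinderAt, zero_add]
  rw [h2] at h
  refine h.congr fun N => ?_
  simp only [bridgeMean, bridge_wordProb, preimage_shift_iterate_cylinderAt]

lemma map_future_wordCylinder (μ : Measure (ℤ → Δ)) {n : ℕ} (w : Fin n → Δ) :
    μ.map (future Δ) (wordCylinder w) = μ (cylinderAt 0 (List.ofFn w)) := by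
  rw [Measure.map_apply measurable_future (measurableSet_wordCylinder w),
    preimage_future_wordCylinder]

lemma eq_of_wordProb_eq [Countable Δ] {μ ρ : Measure (ℤ → Δ)} [IsFiniteMeasure μ]
    [IsFiniteMeasure ρ]
    (hμ : MeasurePreserving (shift Δ) μ μ) (hρ : MeasurePreserving (shift Δ) ρ ρ)
    (h : wordProb μ = wordProb ρ) : μ = ρ := by
  refine ext_of_map_future hμ hρ (ext_of_wordCylinder fun n w => ?_)
  rw [map_future_wordCylinder, map_future_wordCylinder,
    ← ENNReal.toReal_eq_toReal_iff' (measure_ne_top _ _) (measure_ne_top _ _)]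
  exact congrFun h _

end WordProb

/-! ### Dimension in terms of word functions -/

section Dimension

variable {Δ : Type*} [MeasurableSpace Δ]

/-- The values of a signed measure on the word cylinders. -/
def wordValues (Δ : Type*) [MeasurableSpace Δ] :
    SignedMeasure (ℕ → Δ) →ₗ[ℝ] (List Δ → ℝ) where
  toFun s w := s (wordCylinder w.get)
  map_add' _ _ := rfl
  map_smul' _ _ := rfl

lemma wordValues_apply (s : SignedMeasure (ℕ → Δ)) (w : List Δ) :
    wordValues Δ s w = s (wordCylinder w.get) := rfl

variable [DiscreteMeasurableSpace Δ]

lemma wordValues_injective [Countable Δ] : Function.Injective (wordValues Δ) := by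
  rw [← LinearMap.ker_eq_bot, LinearMap.ker_eq_bot']
  intro s hs
  -- The Jordan decomposition reduces uniqueness to two finite measures agreeing on cylinders.
  rw [← s.toSignedMeasure_toJordanDecomposition, JordanDecomposition.toSignedMeasure] at hs ⊢
  have h : s.toJordanDecomposition.posPart = s.toJordanDecomposition.negPart := by
    refine ext_of_wordCylinder fun n w => ?_
    have h1 := congrFun hs (List.ofFn w)
    have h2 := measurableSet_wordCylinder w
    simp only [wordValues_apply, wordCylinder_get_ofFn, sub_apply,
      Measure.toSignedMeasure_apply_measurable h2, Pi.zero_apply,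
      sub_eq_zero] at h1
    rwa [measureReal_def, measureReal_def,
      ENNReal.toReal_eq_toReal_iff' (measure_ne_top _ _) (measure_ne_top _ _)] at h1
  simp [h]

lemma wordValues_wordMeasure (P : Measure (ℤ → Δ)) [IsFiniteMeasure P] {n : ℕ} (w : Fin n → Δ)
    (v : List Δ) :
    wordValues Δ (wordMeasure (P.map (future Δ)) w).toSignedMeasure v =
      wordProb P (List.ofFn w ++ v) := by
  have hv := measurableSet_wordCylinder v.get
  have hd := measurable_dropFirst (Δ := Δ) n hv
  change (wordMeasure (P.map (future Δ)) w).toSignedMeasure (wordCylinder v.get) = _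
  rw [Measure.toSignedMeasure_apply_measurable hv, wordProb, measureReal_def, measureReal_def,
    wordMeasure, Measure.map_apply (measurable_dropFirst n) hv, Measure.restrict_apply hd,
    Measure.map_apply measurable_future (hd.inter (measurableSet_wordCylinder w)),
    Set.preimage_inter, preimage_future_dropFirst, preimage_future_wordCylinder,
    cylinderAt_append, Set.inter_comm]
  simp

lemma dim_eq_rank_translateSpan [Countable Δ] (P : ProbabilityMeasure (ℤ → Δ)) :
    dim P = Cardinal.toENat
      (Module.rank ℝ (translateSpan (wordProb (P : Measure (ℤ → Δ))))) := by
  have h : (canonicalSpace ((P : Measure (ℤ → Δ)).map (future Δ))).map (wordValues Δ) =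
      translateSpan (wordProb (P : Measure (ℤ → Δ))) := by
    rw [canonicalSpace, Submodule.map_span, translateSpan]
    congr 1
    ext f
    constructor
    · rintro ⟨_, ⟨n, w, rfl⟩, rfl⟩
      exact ⟨List.ofFn w, funext fun v => (wordValues_wordMeasure _ w v).symm⟩
    · rintro ⟨w, rfl⟩
      refine ⟨_, ⟨w.length, w.get, rfl⟩, funext fun v => ?_⟩
      rw [wordValues_wordMeasure, List.ofFn_get]
  rw [dim, ← h, (Submodule.equivMapOfInjective _ wordValues_injective _).rank_eq]

end Dimension

lemma eq_zero_of_ae_eq_zero_of_mem_support {E : Type*} [TopologicalSpace E] [MeasurableSpace E]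
    {ν : Measure E} {F : E → ℝ} (hF : Continuous F) (h : ∀ᵐ x ∂ν, F x = 0) {x : E}
    (hx : x ∈ ν.support) : F x = 0 := by
  by_contra hne
  have h1 := (Measure.mem_support_iff_forall x).1 hx {y | F y ≠ 0} (hF.continuousAt.eventually_ne hne)
  exact h1.ne' h

lemma toENNReal_sum {ι : Type*} (s : Finset ι) (f : ι → ℕ∞) :
    ((∑ i ∈ s, f i : ℕ∞) : ℝ≥0∞) = ∑ i ∈ s, (f i : ℝ≥0∞) :=
  map_sum ENat.toENNRealRingHom f s

/-! ### The ergodic decomposition and its support -/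

section Decomposition

variable {Δ : Type*} [MeasurableSpace Δ]

/-- The linear combination of word probabilities with coefficients `a`, as a function of the law. -/
def wordComb (a : List Δ →₀ ℝ) (μ : ErgodicLaw Δ) : ℝ :=
  Finsupp.linearCombination ℝ (wordProb (μ.1 : Measure (ℤ → Δ))) a

instance (μ : ErgodicLaw Δ) : IsProbabilityMeasure (μ.1 : Measure (ℤ → Δ)) := μ.1.2

lemma wordProb_nonneg (μ : Measure (ℤ → Δ)) (w : List Δ) : 0 ≤ wordProb μ w := measureReal_nonneg

lemma wordProb_le_one (μ : Measure (ℤ → Δ)) [IsProbabilityMeasure μ] (w : List Δ) :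
    wordProb μ w ≤ 1 := measureReal_le_one

lemma measurable_measureReal {B : Set (ℤ → Δ)} (hB : MeasurableSet B) :
    Measurable fun μ : ErgodicLaw Δ => (μ.1 : Measure (ℤ → Δ)).real B :=
  ((Measure.measurable_coe hB).comp
    (measurable_subtype_coe.comp measurable_subtype_coe)).ennreal_toReal

lemma integral_measureReal {P : ProbabilityMeasure (ℤ → Δ)}
    {ν : ProbabilityMeasure (ErgodicLaw Δ)} (hν : IsErgodicDecomposition ν P)
    {B : Set (ℤ → Δ)} (hB : MeasurableSet B) :
    ∫ μ : ErgodicLaw Δ, (μ.1 : Measure (ℤ → Δ)).real B ∂(ν : Measure (ErgodicLaw Δ)) =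
      (P : Measure (ℤ → Δ)).real B := by
  rw [measureReal_def, hν B hB]
  exact integral_toReal ((Measure.measurable_coe hB).comp
    (measurable_subtype_coe.comp measurable_subtype_coe)).aemeasurable
    (Eventually.of_forall fun μ => measure_lt_top _ _)

lemma integrable_measureReal (ν : ProbabilityMeasure (ErgodicLaw Δ))
    {B : Set (ℤ → Δ)} (hB : MeasurableSet B) :
    Integrable (fun μ : ErgodicLaw Δ => (μ.1 : Measure (ℤ → Δ)).real B)
      (ν : Measure (ErgodicLaw Δ)) :=
  Integrable.of_bound (measurable_measureReal hB).aestronglyMeasurable 1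
    (Eventually.of_forall fun μ => by
      rw [Real.norm_of_nonneg measureReal_nonneg]; exact measureReal_le_one)

variable [DiscreteMeasurableSpace Δ]

lemma wordProb_injective [Countable Δ] : Function.Injective fun μ : ErgodicLaw Δ =>
    wordProb (μ.1 : Measure (ℤ → Δ)) := by
  rintro ⟨⟨μ, _⟩, hμ⟩ ⟨⟨ρ, _⟩, hρ⟩ h
  exact Subtype.ext (Subtype.ext
    (eq_of_wordProb_eq hμ.toMeasurePreserving hρ.toMeasurePreserving h))

lemma one_le_dim [Countable Δ] (μ : ErgodicLaw Δ) : 1 ≤ dim μ.1 := by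
  rw [dim_eq_rank_translateSpan, Order.one_le_iff_ne_zero, Ne, Cardinal.toENat_eq_zero,
    rank_zero_iff]
  intro h
  have h1 : (⟨_, self_mem_translateSpan _⟩ :
      translateSpan (wordProb (μ.1 : Measure (ℤ → Δ)))) = 0 := Subsingleton.elim _ _
  have h2 := congrFun (congrArg Subtype.val h1) []
  simp [wordProb, cylinderAt] at h2

lemma measurable_wordProb (w : List Δ) :
    Measurable fun μ : ErgodicLaw Δ => wordProb (μ.1 : Measure (ℤ → Δ)) w :=
  measurable_measureReal (measurableSet_cylinderAt 0 w)

lemma integrable_wordProb_mul (ν : ProbabilityMeasure (ErgodicLaw Δ)) (w v : List Δ) :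
    Integrable (fun μ : ErgodicLaw Δ => wordProb (μ.1 : Measure (ℤ → Δ)) w *
      wordProb (μ.1 : Measure (ℤ → Δ)) v) (ν : Measure (ErgodicLaw Δ)) :=
  Integrable.of_bound ((measurable_wordProb w).mul (measurable_wordProb v)).aestronglyMeasurable 1
    (Eventually.of_forall fun μ => by
      rw [Real.norm_of_nonneg (mul_nonneg (wordProb_nonneg _ _) (wordProb_nonneg _ _))]
      exact mul_le_one₀ (wordProb_le_one _ _) (wordProb_nonneg _ _) (wordProb_le_one _ _))

/-- The Gram form of the word probabilities in `L²(ν)`. -/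
def gram (ν : ProbabilityMeasure (ErgodicLaw Δ)) (w v : List Δ) : ℝ :=
  ∫ μ : ErgodicLaw Δ, wordProb (μ.1 : Measure (ℤ → Δ)) w * wordProb (μ.1 : Measure (ℤ → Δ)) v
    ∂(ν : Measure (ErgodicLaw Δ))

/-- Bilinearity of the Gram form: `a = b` gives the squared `L²(ν)` norm, and a single word in one
slot reads off a row entry. -/
lemma linearCombination_gram (ν : ProbabilityMeasure (ErgodicLaw Δ)) (a b : List Δ →₀ ℝ) :
    Integrable (fun μ => wordComb a μ * wordComb b μ) (ν : Measure (ErgodicLaw Δ)) ∧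
    Finsupp.linearCombination ℝ (Finsupp.linearCombination ℝ (gram ν) a) b =
      ∫ μ, wordComb a μ * wordComb b μ ∂(ν : Measure (ErgodicLaw Δ)) := by
  have h : ∀ μ : ErgodicLaw Δ, wordComb a μ * wordComb b μ =
      ∑ v ∈ b.support, ∑ w ∈ a.support, b v * (a w *
        (wordProb (μ.1 : Measure (ℤ → Δ)) w * wordProb (μ.1 : Measure (ℤ → Δ)) v)) := by
    intro μ
    simp only [wordComb, Finsupp.linearCombination_apply, Finsupp.sum, smul_eq_mul,
      Finset.sum_mul_sum]
    rw [Finset.sum_comm]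
    exact Finset.sum_congr rfl fun v _ => Finset.sum_congr rfl fun w _ => by ring
  have hi := fun v w => ((integrable_wordProb_mul ν w v).const_mul (a w)).const_mul (b v)
  simp only [h]
  refine ⟨integrable_finsetSum _ fun v _ => integrable_finsetSum _ fun w _ => hi v w, ?_⟩
  rw [integral_finsetSum _ fun v _ => integrable_finsetSum _ fun w _ => hi v w]
  simp only [integral_finsetSum _ fun w _ => hi _ w, integral_const_mul,
    Finsupp.linearCombination_apply, Finsupp.sum, Finset.sum_apply, Pi.smul_apply, smul_eq_mul,
    Finset.mul_sum, gram]

/-- Bridge means are affine in the law: integrate the ergodic limits, dominated by 1. -/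
lemma tendsto_bridgeMean_gram [Fintype Δ] {P : ProbabilityMeasure (ℤ → Δ)}
    {ν : ProbabilityMeasure (ErgodicLaw Δ)} (hν : IsErgodicDecomposition ν P) (w v : List Δ) :
    Tendsto (fun N => bridgeMean (wordProb (P : Measure (ℤ → Δ))) N w v) atTop
      (𝓝 (gram ν w v)) := by
  have hm : ∀ k : ℕ, MeasurableSet (cylinderAt 0 w ∩ cylinderAt (w.length + k) v) := fun k =>
    (measurableSet_cylinderAt 0 w).inter (measurableSet_cylinderAt _ v)
  have h1 : ∀ N, bridgeMean (wordProb (P : Measure (ℤ → Δ))) N w v =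
      ∫ μ : ErgodicLaw Δ, bridgeMean (wordProb (μ.1 : Measure (ℤ → Δ))) N w v
        ∂(ν : Measure (ErgodicLaw Δ)) := by
    intro N
    simp only [bridgeMean, bridge_wordProb, integral_const_mul]
    rw [integral_finsetSum _ fun k _ => integrable_measureReal ν (hm k)]
    simp only [integral_measureReal hν (hm _)]
  simp only [h1]
  refine tendsto_integral_of_dominated_convergence (fun _ => 1) (fun N => ?_)
    (integrable_const 1) (fun N => Eventually.of_forall fun μ => ?_)
    (Eventually.of_forall fun μ => (averageMultiplicative_wordProb μ.2).tendsto w v)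
  · simp only [bridgeMean, bridge_wordProb]
    exact ((Finset.measurable_sum _ fun k _ =>
      measurable_measureReal (hm k)).const_mul _).aestronglyMeasurable
  · simp only [bridgeMean, bridge_wordProb]
    rw [Real.norm_of_nonneg (mul_nonneg (by positivity)
      (Finset.sum_nonneg fun _ _ => measureReal_nonneg))]
    calc _ ≤ (N : ℝ)⁻¹ * ∑ k ∈ Finset.range N, (1 : ℝ) := by
          gcongr
          exact measureReal_le_one
      _ ≤ 1 := by simpa using inv_mul_le_one (a := (N : ℝ))

variable [TopologicalSpace Δ] [DiscreteTopology Δ] [Finite Δ]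

lemma continuous_wordProb (w : List Δ) :
    Continuous fun μ : ErgodicLaw Δ => wordProb (μ.1 : Measure (ℤ → Δ)) w := by
  rw [continuous_iff_continuousAt]
  intro μ
  have h := ProbabilityMeasure.tendsto_measure_of_null_frontier_of_tendsto
    (continuous_subtype_val.tendsto μ) (E := cylinderAt 0 w)
    (by simp [(isClopen_cylinderAt 0 w).frontier_eq])
  exact (NNReal.continuous_coe.tendsto _).comp h

lemma continuous_wordComb (a : List Δ →₀ ℝ) : Continuous (wordComb a) := by
  unfold wordComb
  simp only [Finsupp.linearCombination_apply, Finsupp.sum]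
  exact continuous_finsetSum _ fun w _ => (continuous_wordProb w).const_smul (a w)

lemma wordProb_mem_translateSpan_of_mem_support {P : ProbabilityMeasure (ℤ → Δ)}
    {ν : ProbabilityMeasure (ErgodicLaw Δ)} (hν : IsErgodicDecomposition ν P)
    [FiniteDimensional ℝ (translateSpan (wordProb (P : Measure (ℤ → Δ))))]
    {μ : ErgodicLaw Δ} (hμ : μ ∈ (ν : Measure (ErgodicLaw Δ)).support) :
    wordProb (μ.1 : Measure (ℤ → Δ)) ∈ translateSpan (wordProb (P : Measure (ℤ → Δ))) := by
  have := Fintype.ofFinite Δ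
  let T := Finsupp.linearCombination ℝ (gram ν)
  have hT : LinearMap.range T ≤ translateSpan (wordProb (P : Measure (ℤ → Δ))) := by
    rw [Finsupp.range_linearCombination, Submodule.span_le]
    rintro _ ⟨w, rfl⟩
    exact mem_translateSpan_of_tendsto (tendsto_bridgeMean_gram hν w)
  have : FiniteDimensional ℝ (LinearMap.range T) := Submodule.finiteDimensional_of_le hT
  have hker : ∀ a, T a = 0 → wordComb a μ = 0 := by
    intro a ha
    obtain ⟨hi, h1⟩ := linearCombination_gram ν a a
    change Finsupp.linearCombination ℝ (T a) a = _ at h1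
    rw [ha] at h1
    have h2 : ∫ μ, wordComb a μ * wordComb a μ ∂(ν : Measure (ErgodicLaw Δ)) = 0 := by
      rw [← h1]; simp
    rw [integral_eq_zero_iff_of_nonneg (fun μ => mul_self_nonneg _) hi] at h2
    exact eq_zero_of_ae_eq_zero_of_mem_support (continuous_wordComb a)
      (h2.mono fun x hx => mul_self_eq_zero.1 hx) hμ
  -- A functional vanishing on `ker T` factors through the range of `T`.
  obtain ⟨l, hl⟩ : Finsupp.linearCombination ℝ (wordProb (μ.1 : Measure (ℤ → Δ))) ∈
      LinearMap.range T.rangeRestrict.dualMap := by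
    rw [LinearMap.range_dualMap_eq_dualAnnihilator_ker, LinearMap.ker_rangeRestrict,
      Submodule.mem_dualAnnihilator]
    exact fun a ha => hker a ha
  obtain ⟨a, ha⟩ := exists_finsupp_of_dual _ l
  refine hT ⟨a, funext fun w => ?_⟩
  -- Symmetry of the Gram form turns evaluation of the row of `w` at `a` into `T a w`.
  have h1 := (linearCombination_gram ν a (Finsupp.single w 1)).2
  have h2 := (linearCombination_gram ν (Finsupp.single w 1) a).2
  simp only [mul_comm (wordComb (Finsupp.single w 1) _)] at h2
  rw [← h1, Finsupp.linearCombination_single, Finsupp.linearCombination_single, one_smul,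
    one_smul] at h2
  have h3 := LinearMap.congr_fun hl (Finsupp.single w 1)
  rw [Finsupp.linearCombination_single, one_smul] at h3
  refine Eq.trans h2.symm (Eq.trans ?_ h3)
  rw [LinearMap.dualMap_apply, ha]
  change _ = Finsupp.linearCombination ℝ (T (Finsupp.single w 1)) a
  rw [Finsupp.linearCombination_single, one_smul]

lemma support_mem_ae_ergodicLaw (ν : ProbabilityMeasure (ErgodicLaw Δ)) :
    ∀ᵐ μ ∂(ν : Measure (ErgodicLaw Δ)), μ ∈ (ν : Measure (ErgodicLaw Δ)).support := by
  have : SecondCountableTopology (ProbabilityMeasure (ℤ → Δ)) := by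
    let := TopologicalSpace.metrizableSpaceMetric (ProbabilityMeasure (ℤ → Δ))
    infer_instance
  exact Measure.support_mem_ae

/-- With a dual basis `a`, the function `wordComb (a ρ)` is the indicator of `ρ` on the support,
which has full measure; its integral is the weight of `ρ`. -/
lemma wordProb_mem_span {P : ProbabilityMeasure (ℤ → Δ)}
    {ν : ProbabilityMeasure (ErgodicLaw Δ)} (hν : IsErgodicDecomposition ν P)
    [Finite (ν : Measure (ErgodicLaw Δ)).support] :
    wordProb (P : Measure (ℤ → Δ)) ∈ Submodule.span ℝ (Set.range
      fun μ : (ν : Measure (ErgodicLaw Δ)).support => wordProb (μ.1.1 : Measure (ℤ → Δ))) := by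
  classical
  have := Fintype.ofFinite Δ
  have := Fintype.ofFinite (ν : Measure (ErgodicLaw Δ)).support
  have hind : LinearIndependent ℝ fun μ : (ν : Measure (ErgodicLaw Δ)).support =>
      wordProb (μ.1.1 : Measure (ℤ → Δ)) :=
    AverageMultiplicative.linearIndependent (fun μ => averageMultiplicative_wordProb μ.1.2)
      (wordProb_injective.comp Subtype.val_injective)
  choose a ha using exists_finsupp_dual_basis hind
  have key : wordProb (P : Measure (ℤ → Δ)) = ∑ ρ : (ν : Measure (ErgodicLaw Δ)).support,
      (∫ μ, wordComb (a ρ) μ ∂(ν : Measure (ErgodicLaw Δ))) •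
        wordProb (ρ.1.1 : Measure (ℤ → Δ)) := by
    ext w
    have h1 : wordProb (P : Measure (ℤ → Δ)) w =
        ∫ μ : ErgodicLaw Δ, ∑ ρ : (ν : Measure (ErgodicLaw Δ)).support,
          wordComb (a ρ) μ * wordProb (ρ.1.1 : Measure (ℤ → Δ)) w
            ∂(ν : Measure (ErgodicLaw Δ)) := by
      rw [wordProb, ← integral_measureReal hν (measurableSet_cylinderAt 0 w)]
      refine integral_congr_ae ((support_mem_ae_ergodicLaw ν).mono fun μ hμ => ?_)
      have h2 : ∀ ρ, wordComb (a ρ) μ = if (⟨μ, hμ⟩ : (ν : Measure (ErgodicLaw Δ)).support) = ρ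
          then 1 else 0 := fun ρ => ha ρ ⟨μ, hμ⟩
      simp [h2, wordProb]
    have hi : ∀ ρ, Integrable (wordComb (a ρ)) (ν : Measure (ErgodicLaw Δ)) := by
      intro ρ
      have h := (linearCombination_gram ν (a ρ) (Finsupp.single [] 1)).1
      refine h.congr (Eventually.of_forall fun μ => ?_)
      simp [wordComb, wordProb, cylinderAt]
    rw [h1, integral_finsetSum _ fun ρ _ => (hi ρ).mul_const _]
    simp [integral_mul_const]
  rw [key]
  exact Submodule.sum_mem _ fun ρ _ => Submodule.smul_mem _ _ (Submodule.subset_span ⟨ρ, rfl⟩)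

lemma translateSpan_le_iSup {P : ProbabilityMeasure (ℤ → Δ)}
    {ν : ProbabilityMeasure (ErgodicLaw Δ)} (hν : IsErgodicDecomposition ν P)
    [Finite (ν : Measure (ErgodicLaw Δ)).support] :
    translateSpan (wordProb (P : Measure (ℤ → Δ))) ≤
      ⨆ μ : (ν : Measure (ErgodicLaw Δ)).support,
        translateSpan (wordProb (μ.1.1 : Measure (ℤ → Δ))) := by
  rw [translateSpan, Submodule.span_le]
  rintro _ ⟨w, rfl⟩
  let L : (List Δ → ℝ) →ₗ[ℝ] (List Δ → ℝ) := LinearMap.funLeft ℝ ℝ (w ++ ·)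
  have h : L (wordProb (P : Measure (ℤ → Δ))) ∈ (Submodule.span ℝ (Set.range
      fun μ : (ν : Measure (ErgodicLaw Δ)).support =>
        wordProb (μ.1.1 : Measure (ℤ → Δ)))).map L :=
    Submodule.mem_map_of_mem (wordProb_mem_span hν)
  refine (Submodule.map_span_le L _ _).2 ?_ h
  rintro _ ⟨μ, rfl⟩
  exact Submodule.mem_iSup_of_mem μ (translate_mem _ w)

end Decomposition

end ProcessDimension

end

/-! ### The dimension formula -/

theorem mainTheorem3 {Δ : Type*} [Finite Δ] [TopologicalSpace Δ] [DiscreteTopology Δ]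
    [MeasurableSpace Δ] [DiscreteMeasurableSpace Δ]
    (P : ProbabilityMeasure (ℤ → Δ)) (hP : ProcessDimension.IsStationary P)
    (ν : ProbabilityMeasure (ProcessDimension.ErgodicLaw Δ))
    (hν : ProcessDimension.IsErgodicDecomposition ν P) :
    (ProcessDimension.dim P : ℝ≥0∞) =
      ∑' μ : (ν : Measure (ProcessDimension.ErgodicLaw Δ)).support,
        (ProcessDimension.dim μ.1.1 : ℝ≥0∞) := by
  have := Fintype.ofFinite Δ
  apply le_antisymm
  · rcases finite_or_infinite (ν : Measure (ProcessDimension.ErgodicLaw Δ)).support with hs | hs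
    · have := Fintype.ofFinite (ν : Measure (ProcessDimension.ErgodicLaw Δ)).support
      rw [tsum_fintype]
      simp only [ProcessDimension.dim_eq_rank_translateSpan]
      have h := ProcessDimension.toENat_rank_le_sum _ _
        (ProcessDimension.translateSpan_le_iSup hν)
      rw [← ProcessDimension.toENNReal_sum]
      exact ENat.toENNReal_le.2 h
    · refine le_top.trans (top_le_iff.2 (top_unique ?_)).ge
      rw [← ENNReal.tsum_const_eq_top_of_ne_zero
        (α := (ν : Measure (ProcessDimension.ErgodicLaw Δ)).support) one_ne_zero]
      refine ENNReal.tsum_le_tsum fun μ => ?_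
      exact_mod_cast ProcessDimension.one_le_dim μ.1
  · by_cases hfin : FiniteDimensional ℝ
        (ProcessDimension.translateSpan (ProcessDimension.wordProb (P : Measure (ℤ → Δ))))
    · rw [ENNReal.tsum_eq_iSup_sum]
      refine iSup_le fun s => ?_
      simp only [ProcessDimension.dim_eq_rank_translateSpan]
      have h := ProcessDimension.sum_toENat_rank_le s
        (fun μ : (ν : Measure (ProcessDimension.ErgodicLaw Δ)).support =>
          ProcessDimension.translateSpan (ProcessDimension.wordProb (μ.1.1 : Measure (ℤ → Δ))))
        (ProcessDimension.translateSpan (ProcessDimension.wordProb (P : Measure (ℤ → Δ))))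
        (fun μ _ => ProcessDimension.translateSpan_le
          (ProcessDimension.wordProb_mem_translateSpan_of_mem_support hν μ.2))
        (fun f hf h0 => ProcessDimension.AverageMultiplicative.eq_zero_of_sum_eq_zero
          (fun μ => ProcessDimension.averageMultiplicative_wordProb μ.1.2)
          (ProcessDimension.wordProb_injective.comp Subtype.val_injective) hf h0)
      rw [← ProcessDimension.toENNReal_sum]
      exact ENat.toENNReal_le.2 h
    · have h : ProcessDimension.dim P = ⊤ := by
        rw [ProcessDimension.dim_eq_rank_translateSpan, Cardinal.toENat_eq_top, ← not_lt,
          Module.rank_lt_aleph0_iff]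
        exact hfin
      simp [h]
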